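/- Let $G$ and $H$ be profinite groups, regarded as first-order structures in the language of groups $\{\cdot,{}^{-1},1\}$. Let $A\subseteq G$ be a (possibly empty) subset and let $f:A\to H$ be an elementary map, that is, for every $n\ge 0$, every first-order formula $\varphi(x_1,\dots,x_n)$ in the language of groups and all $a_1,\dots,a_n\in A$ one has $G\models\varphi(a_1,\dots,a_n)$ if and only if $H\models\varphi(f(a_1),\dots,f(a_n))$. Suppose that at least one of $G$ and $H$ is strongly complete, meaning that all of its subgroups of finite index are open. Then $f$ extends to an isomorphism of profinite groups $G\to H$, i.e. there is an isomorphism of groups $e:G\to H$ which is also a homeomorphism and satisfies $e(a)=f(a)$ for all $a\in A$. -/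

import Mathlib

/-- Function symbols of the language of groups: multiplication, inversion, identity. -/
inductive GroupFunc : ℕ → Type
  | mul : GroupFunc 2
  | inv : GroupFunc 1
  | one : GroupFunc 0

/-- The first-order language of groups (no relation symbols; equality is logical). -/
def groupLanguage : FirstOrder.Language.{0, 0} where
  Functions := GroupFunc
  Relations := fun _ => Empty

/-- Every group is a structure for the language of groups in the standard way. -/
instance groupStructure (G : Type*) [Group G] : groupLanguage.Structure G where
  funMap := fun {n} (s : GroupFunc n) =>
    match n, s with
    | _, .mul => fun v => v 0 * v 1
    | _, .inv => fun v => (v 0)⁻¹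
    | _, .one => fun _ => 1
  RelMap := fun {_} r _ => Empty.elim r

/-- A (partial) elementary map `f : A → N`, with `A ⊆ M`: it preserves and reflects the truth of
all first-order formulas at tuples from `A`. The case `n = 0` says that `M` and `N` satisfy the same
sentences, also when `A` is empty. -/
def IsElementaryMap (L : FirstOrder.Language) {M N : Type*} [L.Structure M] [L.Structure N]
    (A : Set M) (f : A → N) : Prop :=
  ∀ ⦃n : ℕ⦄ (φ : L.Formula (Fin n)) (a : Fin n → A),
    φ.Realize (fun i => (a i : M)) ↔ φ.Realize (fun i => f (a i))

/-- A topological (in particular, a profinite) group is strongly complete if all its subgroups of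
finite index are open. -/
def IsStronglyComplete (G : Type*) [Group G] [TopologicalSpace G] : Prop :=
  ∀ K : Subgroup G, K.FiniteIndex → IsOpen (K : Set G)

/-! Let `G` be strongly complete; otherwise pass to the inverse of `f`. For a finite group `F` there
are only finitely many homomorphisms `G →* F` (`IsStronglyComplete.finite_monoidHom`), so their
common kernel `K` is open. Elements of `K` are recognised by finite sets of witnesses, which makes
`K` a countable union of closed definable sets; by Baire and compactness it is a product of two of
them, hence definable (`IsStronglyComplete.exists_eq_forcedTrivial_mul`).

In `H` the same formula defines a closed set lying in every kernel of a homomorphism to `F`; being a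
subgroup of index at most that of `K` transfers as first-order sentences, so this subgroup is open.
With `F` running through the finite continuous quotients of `G` and `H`, such pairs of subgroups
form neighbourhood bases at 1 on both sides.

Compactness of `G → H` extends `f` to a homomorphism `θ` that pulls each definable open subgroup of
`H` back to its partner in `G` (`IsElementaryMap.exists_monoidHom`). This makes `θ` injective and
continuous, and comparing indices gives dense, hence full, image. -/

/-! ### Finiteness of the set of homomorphisms to a finite group -/

/-- A homomorphism from a strongly complete group to a finite group has open fibres. -/
theorem IsStronglyComplete.isOpen_preimage {G F : Type*} [Group G] [TopologicalSpace G]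
    [IsTopologicalGroup G] [Group F] [Finite F] (hG : IsStronglyComplete G) (φ : G →* F)
    (s : Set F) : IsOpen (φ ⁻¹' s) := by
  let _ : TopologicalSpace F := ⊥
  have : DiscreteTopology F := ⟨rfl⟩
  have hker : IsOpen (φ.ker : Set G) := hG _ inferInstance
  have hc : Continuous φ := by
    refine continuous_of_continuousAt_one φ ?_
    rw [ContinuousAt, map_one, nhds_discrete F, Filter.tendsto_pure]
    exact hker.mem_nhds (one_mem _)
  exact hc.isOpen_preimage s (isOpen_discrete s)

/-- The set where two homomorphisms to a finite group agree is closed if the source is strongly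
complete. -/
theorem IsStronglyComplete.isClosed_eqLocus {G F : Type*} [Group G] [TopologicalSpace G]
    [IsTopologicalGroup G] [Group F] [Finite F] (hG : IsStronglyComplete G) (φ ψ : G →* F) :
    IsClosed {g | φ g = ψ g} := by
  let _ : TopologicalSpace F := ⊥
  have : DiscreteTopology F := ⟨rfl⟩
  exact isClosed_eq (continuous_def.2 fun s _ => hG.isOpen_preimage φ s)
    (continuous_def.2 fun s _ => hG.isOpen_preimage ψ s)

/-- A pointwise ultralimit of homomorphisms to a finite group is a homomorphism. -/
theorem exists_ultralimit_monoidHom {G F ι : Type*} [Group G] [Group F] [Finite F]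
    (φ : ι → G →* F) (U : Ultrafilter ι) :
    ∃ ψ : G →* F, ∀ g, ∀ᶠ i in (U : Filter ι), φ i g = ψ g := by
  have h : ∀ g, ∃ v, ∀ᶠ i in (U : Filter ι), φ i g = v := by
    intro g
    obtain ⟨v, hv⟩ := (U.map fun i => φ i g).eq_pure_of_finite
    refine ⟨v, ?_⟩
    have : {v} ∈ U.map fun i => φ i g := by rw [hv]; exact Set.mem_singleton v
    exact this
  choose ψ hψ using h
  refine ⟨MonoidHom.mk' ψ fun a b => ?_, hψ⟩
  obtain ⟨i, hi, ha, hb⟩ := ((hψ (a * b)).and ((hψ a).and (hψ b))).exists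
  rw [← hi, ← ha, ← hb, map_mul]

/-- A sequence of homomorphisms from a strongly complete compact group to a finite group has a
pointwise (eventually constant) convergent subsequence. -/
theorem IsStronglyComplete.exists_pointwise_subseq {G F : Type*} [Group G] [TopologicalSpace G]
    [IsTopologicalGroup G] [CompactSpace G] [Group F] [Finite F] (hG : IsStronglyComplete G)
    (φ : ℕ → G →* F) :
    ∃ (ψ : G →* F) (k : ℕ → ℕ), StrictMono k ∧
      ∀ g, ∀ᶠ n in Filter.atTop, φ (k n) g = ψ g := by
  let _ : TopologicalSpace F := ⊥
  have : DiscreteTopology F := ⟨rfl⟩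
  let Φ : G → ℕ → F := fun g n => φ n g
  have hΦ : Continuous Φ := continuous_pi fun n =>
    continuous_def.2 fun s _ => hG.isOpen_preimage (φ n) s
  -- The image of `Φ` lies in the second countable space `ℕ → F`, so convergence need only be
  -- arranged on countably many lifts `d x`.
  obtain ⟨D, hDc, hD⟩ := TopologicalSpace.exists_countable_dense (Set.range Φ)
  have : Countable D := hDc
  choose d hd using fun x : D => x.1.2
  obtain ⟨lim, -, k, hk, hlim⟩ := (isCompact_univ (X := D → F)).tendsto_subseq
    (x := fun n x => φ n (d x)) fun _ => Set.mem_univ _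
  have hlimD : ∀ x, ∀ᶠ n in Filter.atTop, φ (k n) (d x) = lim x := fun x => by
    have := (tendsto_pi_nhds.1 hlim) x
    rwa [nhds_discrete, Filter.tendsto_pure] at this
  -- Homomorphisms trivial on the kernel of `Φ` are determined by their values on the lifts: the
  -- image under `Φ` of their agreement set is compact and contains the dense set `D`.
  have key : ∀ ψ₁ ψ₂ : G →* F,
      (∀ g, (∀ n, φ n g = 1) → ψ₁ g = 1) → (∀ g, (∀ n, φ n g = 1) → ψ₂ g = 1) →
      (∀ x, ψ₁ (d x) = ψ₂ (d x)) → ψ₁ = ψ₂ := by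
    intro ψ₁ ψ₂ h₁ h₂ h
    have hcl : IsClosed (Φ '' {g | ψ₁ g = ψ₂ g}) :=
      (((hG.isClosed_eqLocus ψ₁ ψ₂).isCompact).image hΦ).isClosed
    ext g
    have hmem : (⟨Φ g, g, rfl⟩ : Set.range Φ) ∈ closure D := hD _
    have hsub : D ⊆ Subtype.val ⁻¹' (Φ '' {g | ψ₁ g = ψ₂ g}) := fun x hx =>
      ⟨d ⟨x, hx⟩, h ⟨x, hx⟩, hd ⟨x, hx⟩⟩
    obtain ⟨g', hg', he⟩ :=
      closure_minimal hsub (hcl.preimage continuous_subtype_val) hmem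
    have hq : ∀ n, φ n (g' ⁻¹ * g) = 1 := fun n => by
      have : φ n g' = φ n g := congrFun he n
      rw [map_mul, map_inv, this, inv_mul_cancel]
    have e₁ := h₁ _ hq
    have e₂ := h₂ _ hq
    rw [map_mul, map_inv, inv_mul_eq_one] at e₁ e₂
    rw [← e₁, ← e₂]
    exact hg'
  obtain ⟨ψ, hψ⟩ := exists_ultralimit_monoidHom (fun n => φ (k n))
    (Filter.hyperfilter ℕ)
  have aux : ∀ (U : Ultrafilter ℕ) (ψ' : G →* F), (U : Filter ℕ) ≤ Filter.atTop →
      (∀ g, ∀ᶠ i in (U : Filter ℕ), φ (k i) g = ψ' g) →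
      (∀ g, (∀ n, φ n g = 1) → ψ' g = 1) ∧ ∀ x, ψ' (d x) = lim x := by
    refine fun U ψ' hU h => ⟨fun g hg => ?_, fun x => ?_⟩
    · obtain ⟨i, hi⟩ := (h g).exists
      rw [← hi, hg]
    · obtain ⟨i, hi, hi'⟩ := ((h (d x)).and (hU (hlimD x))).exists
      rw [← hi, hi']
  refine ⟨ψ, k, hk, fun g => ?_⟩
  have : Filter.Tendsto (fun n => φ (k n) g) Filter.atTop (nhds (ψ g)) := by
    -- By `key`, all ultralimits of the subsequence coincide, which is convergence.
    refine (Filter.tendsto_iff_ultrafilter _ _ _).2 fun U hU => ?_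
    obtain ⟨ψ', hψ'⟩ := exists_ultralimit_monoidHom (fun n => φ (k n)) U
    have h₁ := aux _ ψ (Nat.hyperfilter_le_atTop) hψ
    have h₂ := aux U ψ' hU hψ'
    rw [key ψ ψ' h₁.1 h₂.1 fun x => (h₁.2 x).trans (h₂.2 x).symm, nhds_discrete,
      Filter.tendsto_pure]
    exact hψ' g
  rwa [nhds_discrete, Filter.tendsto_pure] at this

/-- Homomorphisms to a finite group that agree on a given subgroup of finite index are finite in
number. -/
theorem finite_setOf_eqOn_subgroup {G F : Type*} [Group G] [Group F] [Finite F] (U : Subgroup G)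
    [U.FiniteIndex] (ψ : G →* F) : {φ : G →* F | ∀ u ∈ U, φ u = ψ u}.Finite := by
  have : Finite (G ⧸ U) := inferInstance
  refine Set.Finite.of_finite_image (f := fun φ (q : G ⧸ U) => φ q.out) (Set.toFinite _) ?_
  intro φ₁ h₁ φ₂ h₂ he
  ext g
  obtain ⟨u, hu⟩ := QuotientGroup.mk_out_eq_mul U g
  have h := congrFun he (g : G ⧸ U)
  simp only [hu, map_mul, h₁ u u.2, h₂ u u.2] at h
  exact mul_right_cancel h

/-- A strongly complete compact group has only finitely many homomorphisms to a finite group. -/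
theorem IsStronglyComplete.finite_monoidHom {G F : Type*} [Group G] [TopologicalSpace G]
    [IsTopologicalGroup G] [CompactSpace G] [T2Space G] [Group F] [Finite F]
    (hG : IsStronglyComplete G) : Finite (G →* F) := by
  by_contra hinf
  rw [not_finite_iff_infinite] at hinf
  let φ := Infinite.natEmbedding (G →* F)
  obtain ⟨ψ, k, hk, h⟩ := hG.exists_pointwise_subseq (fun n => φ n)
  let S : ℕ → Set G := fun N => ⋂ n ≥ N, {g | φ (k n) g = ψ g}
  have hS : ∀ N, IsClosed (S N) := fun N =>
    isClosed_biInter fun n _ => hG.isClosed_eqLocus _ _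
  have hU : ⋃ N, S N = Set.univ := by
    refine Set.eq_univ_of_forall fun g => ?_
    obtain ⟨N, hN⟩ := Filter.eventually_atTop.1 (h g)
    exact Set.mem_iUnion.2 ⟨N, Set.mem_iInter₂.2 hN⟩
  -- Baire: some `S N` has interior. It is a subgroup, hence open of finite index, and infinitely
  -- many distinct `φ (k n)` agree with `ψ` on it.
  obtain ⟨N, g₀, hg₀⟩ := nonempty_interior_of_iUnion_of_closed hS hU
  let U : Subgroup G := ⨅ n : Set.Ici N, (φ (k n)).eqLocus ψ
  have hUmem : ∀ u, u ∈ U ↔ u ∈ S N := fun u => by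
    simp [U, S, Subgroup.mem_iInf]
    rfl
  have hUo : IsOpen (U : Set G) := by
    refine U.isOpen_of_mem_nhds (g := g₀) ?_
    exact Filter.mem_of_superset (mem_interior_iff_mem_nhds.1 hg₀) fun u hu => (hUmem u).2 hu
  have : U.FiniteIndex := by
    have := U.quotient_finite_of_isOpen hUo
    exact Subgroup.finiteIndex_of_finite_quotient
  refine Set.infinite_of_injective_forall_mem (f := fun n => φ (k (N + n))) ?_ ?_
    (finite_setOf_eqOn_subgroup U ψ)
  · intro a b hab
    exact Nat.add_left_cancel (hk.injective (φ.injective hab))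
  · intro n u hu
    exact Set.mem_iInter₂.1 ((hUmem u).1 hu) (N + n) (Nat.le_add_right _ _)

/-! ### Definable sets of elements forced to be trivial in a finite group -/

/-- The formula `xᵢ * xⱼ = xₖ`. -/
def mulEqFormula {α : Type*} (i j k : α) : groupLanguage.Formula α :=
  FirstOrder.Language.Term.equal
    (FirstOrder.Language.Term.func (L := groupLanguage) (l := 2) GroupFunc.mul
      ![FirstOrder.Language.Term.var i, FirstOrder.Language.Term.var j])
    (FirstOrder.Language.Term.var k)

theorem realize_mulEqFormula {α G : Type*} [Group G] (i j k : α) (v : α → G) :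
    (mulEqFormula i j k).Realize v ↔ v i * v j = v k := by
  simp only [mulEqFormula, FirstOrder.Language.Formula.realize_equal,
    FirstOrder.Language.Term.realize_var]
  rfl

/-- The set defined in a group by a formula in one variable. -/
def solutionSet (G : Type*) [Group G] (φ : groupLanguage.Formula Unit) : Set G :=
  {x | φ.Realize fun _ => x}

/-- The elements `x` for which some `m` further elements witness that `x` has no nontrivial image
under any homomorphism to `F`: no assignment of values in `F` that respects the products among `x`
and the witnesses sends `x` to a nontrivial element. -/
def forcedTrivial (G F : Type*) [Group G] [Group F] (m : ℕ) : Set G :=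
  {x | ∃ y : Fin m → G, ∀ c : Unit ⊕ Fin m → F, c (Sum.inl ()) = 1 ∨
    ∃ i j k, Sum.elim (fun _ => x) y i * Sum.elim (fun _ => x) y j = Sum.elim (fun _ => x) y k ∧
      c i * c j ≠ c k}

/-- The formula defining `forcedTrivial`. -/
noncomputable def forcedTrivialFormula (F : Type*) [Group F] [Finite F] (m : ℕ) :
    groupLanguage.Formula Unit :=
  FirstOrder.Language.Formula.iExs (Fin m)
    (FirstOrder.Language.Formula.iInf fun c : {c : Unit ⊕ Fin m → F // c (Sum.inl ()) ≠ 1} =>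
      FirstOrder.Language.Formula.iSup
        fun t : {t : (Unit ⊕ Fin m) × (Unit ⊕ Fin m) × (Unit ⊕ Fin m) //
          c.1 t.1 * c.1 t.2.1 ≠ c.1 t.2.2} => mulEqFormula t.1.1 t.1.2.1 t.1.2.2)

theorem solutionSet_forcedTrivialFormula (G F : Type*) [Group G] [Group F] [Finite F] (m : ℕ) :
    solutionSet G (forcedTrivialFormula F m) = forcedTrivial G F m := by
  ext x
  simp only [solutionSet, forcedTrivialFormula, forcedTrivial, Set.mem_ofPred_eq,
    FirstOrder.Language.Formula.realize_iExs, FirstOrder.Language.Formula.realize_iInf,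
    FirstOrder.Language.Formula.realize_iSup, realize_mulEqFormula, Subtype.forall,
    Subtype.exists, Prod.exists, or_iff_not_imp_left, ne_eq, exists_prop, and_comm]

theorem one_mem_forcedTrivial (G F : Type*) [Group G] [Group F] (m : ℕ) :
    (1 : G) ∈ forcedTrivial G F m := by
  refine ⟨fun _ => 1, fun c => or_iff_not_imp_left.2 fun h => ?_⟩
  exact ⟨Sum.inl (), Sum.inl (), Sum.inl (), by simp, by simpa using h⟩

theorem map_eq_one_of_mem_forcedTrivial {G F : Type*} [Group G] [Group F] {m : ℕ} {x : G}
    (hx : x ∈ forcedTrivial G F m) (φ : G →* F) : φ x = 1 := by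
  obtain ⟨y, hy⟩ := hx
  obtain h | ⟨i, j, k, h, h'⟩ := hy fun i => φ (Sum.elim (fun _ => x) y i)
  · exact h
  · exact absurd (by rw [← map_mul, h]) h'

/-- The condition is positive in `G`: only equations between elements of `G` occur, and the
inequalities live in `F`. It is therefore closed in `x` and the witnesses jointly, and projecting
along compact `Fin m → G` keeps it closed. -/
theorem isClosed_forcedTrivial (G F : Type*) [Group G] [TopologicalSpace G] [IsTopologicalGroup G]
    [CompactSpace G] [T2Space G] [Group F] [Finite F] (m : ℕ) :
    IsClosed (forcedTrivial G F m) := by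
  have h : IsClosed {p : G × (Fin m → G) | ∀ c : Unit ⊕ Fin m → F, c (Sum.inl ()) = 1 ∨
      ∃ i j k, Sum.elim (fun _ => p.1) p.2 i * Sum.elim (fun _ => p.1) p.2 j =
        Sum.elim (fun _ => p.1) p.2 k ∧ c i * c j ≠ c k} := by
    have hc : ∀ i : Unit ⊕ Fin m,
        Continuous fun p : G × (Fin m → G) => Sum.elim (fun _ => p.1) p.2 i := by
      rintro (i | i)
      · exact continuous_fst
      · exact (continuous_apply i).comp continuous_snd
    simp only [Set.ofPred_forall, Set.ofPred_or, Set.ofPred_exists]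
    refine isClosed_iInter fun c => isClosed_const.union ?_
    exact isClosed_iUnion_of_finite fun i => isClosed_iUnion_of_finite fun j =>
      isClosed_iUnion_of_finite fun k =>
        (isClosed_eq ((hc i).mul (hc j)) (hc k)).inter isClosed_const
  have := (h.isCompact.image continuous_fst).isClosed
  convert this using 1
  ext x
  simp [forcedTrivial]

/-- The maps `c : G → F` that are multiplicative on the products with all three terms in `s`. -/
def partialHoms (F : Type*) {G : Type*} [Group G] [Group F] (s : Set G) : Set (G → F) :=
  {c | ∀ a ∈ s, ∀ b ∈ s, a * b ∈ s → c (a * b) = c a * c b}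

/-- Replacing tuples by finite sets makes monotonicity in `m` evident and yields the directed family
needed for compactness. -/
theorem mem_forcedTrivial_iff_finset {G F : Type*} [Group G] [Group F] {m : ℕ} {x : G} :
    x ∈ forcedTrivial G F m ↔ ∃ s : Finset G, s.card ≤ m ∧
      ∀ c ∈ partialHoms F (insert x (s : Set G)), c x = 1 := by
  classical
  constructor
  · rintro ⟨y, hy⟩
    refine ⟨Finset.univ.image y, Finset.card_image_le.trans (by simp), fun c hc => ?_⟩
    have hz : ∀ i, Sum.elim (fun _ : Unit => x) y i ∈
        insert x ((Finset.univ.image y : Finset G) : Set G) := by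
      rintro (i | i) <;> simp
    obtain h | ⟨i, j, k, h, h'⟩ := hy fun i => c (Sum.elim (fun _ => x) y i)
    · exact h
    · refine absurd ?_ h'
      rw [← hc _ (hz i) _ (hz j) (h ▸ hz k), h]
  · rintro ⟨s, hm, h⟩
    -- Surplus slots are padded with `x`.
    let y : Fin m → G := fun i => if h : (i : ℕ) < s.card then s.equivFin.symm ⟨i, h⟩ else x
    -- Several slots may carry the value `x`; its index must be `Sum.inl ()`, the one whose colour
    -- is tested.
    have hy : ∀ a : G, ∃ i, a ∈ insert x (s : Set G) →
        Sum.elim (fun _ : Unit => x) y i = a ∧ (a = x → i = Sum.inl ()) := by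
      intro a
      by_cases hx : a = x
      · exact ⟨Sum.inl (), fun _ => ⟨hx.symm, fun _ => rfl⟩⟩
      by_cases ha : a ∈ s
      · let i := s.equivFin ⟨a, ha⟩
        exact ⟨Sum.inr ⟨i, i.2.trans_le hm⟩, fun _ => ⟨by simp [y, i], fun h => absurd h hx⟩⟩
      · exact ⟨Sum.inl (), fun h => absurd h (by simp [hx, ha])⟩
    choose idx hidx using hy
    refine ⟨y, fun c => ?_⟩
    by_contra! hcon
    obtain ⟨hc1, hc⟩ := hcon
    refine hc1 ?_
    have hx := (hidx x (Set.mem_insert _ _)).2 rfl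
    rw [← hx]
    refine h (fun a => c (idx a)) fun a ha b hb hab => (hc _ _ _ ?_).symm
    rw [(hidx a ha).1, (hidx b hb).1, (hidx _ hab).1]

theorem forcedTrivial_mono (G F : Type*) [Group G] [Group F] : Monotone (forcedTrivial G F) := by
  intro m n hmn x hx
  obtain ⟨s, hs, h⟩ := mem_forcedTrivial_iff_finset.1 hx
  exact mem_forcedTrivial_iff_finset.2 ⟨s, hs.trans hmn, h⟩

/-- An element killed by all homomorphisms to the finite group `F` is already forced to be trivial
by finitely many witnesses. -/
theorem exists_mem_forcedTrivial {G F : Type*} [Group G] [Group F] [Finite F] {x : G}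
    (hx : ∀ φ : G →* F, φ x = 1) : ∃ m, x ∈ forcedTrivial G F m := by
  classical
  by_contra! hcon
  let _ : TopologicalSpace F := ⊥
  have : DiscreteTopology F := ⟨rfl⟩
  -- If no finite set of witnesses works, the `C s` are nonempty, closed and directed in the compact
  -- space `G → F`; a common point is a homomorphism not killing `x`.
  let C : Finset G → Set (G → F) := fun s => partialHoms F (insert x (s : Set G)) ∩ {c | c x ≠ 1}
  have hmono : ∀ s t : Finset G, s ⊆ t → C t ⊆ C s := fun s t hst c hc =>
    ⟨fun a ha b hb hab => hc.1 a (Set.insert_subset_insert (by exact_mod_cast hst) ha) b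
      (Set.insert_subset_insert (by exact_mod_cast hst) hb)
      (Set.insert_subset_insert (by exact_mod_cast hst) hab), hc.2⟩
  have hcl : ∀ s, IsClosed (C s) := by
    intro s
    refine IsClosed.inter ?_ ?_
    · simp only [partialHoms, Set.ofPred_forall]
      exact isClosed_iInter fun a => isClosed_iInter fun _ => isClosed_iInter fun b =>
        isClosed_iInter fun _ => isClosed_iInter fun _ =>
          isClosed_eq (continuous_apply _) ((continuous_apply a).mul (continuous_apply b))
    · exact IsClosed.preimage (continuous_apply (A := fun _ : G => F) x)
        (isClosed_discrete {v : F | v ≠ 1})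
  obtain ⟨c, hc⟩ := IsCompact.nonempty_iInter_of_directed_nonempty_isCompact_isClosed C
    (fun s t => ⟨s ∪ t, hmono _ _ Finset.subset_union_left, hmono _ _ Finset.subset_union_right⟩)
    (fun s => by
      by_contra hne
      refine hcon s.card (mem_forcedTrivial_iff_finset.2 ⟨s, le_rfl, fun c hc => ?_⟩)
      by_contra h1
      exact hne ⟨c, hc, h1⟩)
    (fun s => (hcl s).isCompact) hcl
  rw [Set.mem_iInter] at hc
  refine (hc ∅).2 (hx (MonoidHom.mk' c fun a b => ?_))
  exact (hc {a, b, a * b}).1 a (by simp) b (by simp) (by simp)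

/-! ### Definability of the common kernel -/

open scoped Pointwise in
/-- In a strongly complete compact Hausdorff group, the common kernel of all homomorphisms to a finite
group `F` is open, and is a product of two of the sets `forcedTrivial G F m`. -/
theorem IsStronglyComplete.exists_eq_forcedTrivial_mul (G F : Type*) [Group G] [TopologicalSpace G]
    [IsTopologicalGroup G] [CompactSpace G] [T2Space G] [Group F] [Finite F]
    (hG : IsStronglyComplete G) :
    ∃ m, IsOpen ((⨅ φ : G →* F, φ.ker : Subgroup G) : Set G) ∧
      ((⨅ φ : G →* F, φ.ker : Subgroup G) : Set G) =
        forcedTrivial G F m * forcedTrivial G F m := by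
  have := hG.finite_monoidHom (F := F)
  set K : Subgroup G := ⨅ φ : G →* F, φ.ker with hK
  have hKmem : ∀ x, x ∈ K ↔ ∀ φ : G →* F, φ x = 1 := fun x => by
    simp [hK, Subgroup.mem_iInf, MonoidHom.mem_ker]
  have hKo : IsOpen (K : Set G) := hG K (Subgroup.finiteIndex_iInf fun φ => inferInstance)
  have hKcpt : CompactSpace K :=
    isCompact_iff_compactSpace.1 (K.isClosed_of_isOpen hKo).isCompact
  let E : ℕ → Set K := fun m => Subtype.val ⁻¹' forcedTrivial G F m
  have hEcl : ∀ m, IsClosed (E m) := fun m =>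
    (isClosed_forcedTrivial G F m).preimage continuous_subtype_val
  have hEU : ⋃ m, E m = Set.univ := Set.eq_univ_of_forall fun x => by
    obtain ⟨m, hm⟩ := exists_mem_forcedTrivial ((hKmem x).1 x.2)
    exact Set.mem_iUnion.2 ⟨m, hm⟩
  obtain ⟨m, hm⟩ := nonempty_interior_of_iUnion_of_closed hEcl hEU
  obtain ⟨t, ht⟩ := compact_covered_by_mul_left_translates (isCompact_univ (X := K)) hm
  have hsub : ∀ n, forcedTrivial G F n ⊆ K := fun n x hx =>
    (hKmem x).2 (map_eq_one_of_mem_forcedTrivial hx)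
  choose e he using fun x : K => exists_mem_forcedTrivial ((hKmem x).1 x.2)
  -- Writing `x = g⁻¹ * (g * x)` with `g ∈ t` and `g * x` in the `m`-th set, `N` serves both
  -- factors.
  let N := max m (t.sup fun x => e x⁻¹)
  refine ⟨N, hKo, Set.Subset.antisymm (fun x hx => ?_) ?_⟩
  · obtain ⟨g, hg, hxg⟩ := Set.mem_iUnion₂.1 (ht (Set.mem_univ (⟨x, hx⟩ : K)))
    refine ⟨(g : G)⁻¹, ?_, g * x, ?_, by simp⟩
    · refine forcedTrivial_mono G F ?_ (he g⁻¹)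
      exact (Finset.le_sup (f := fun x => e x⁻¹) hg).trans (le_max_right _ _)
    · exact forcedTrivial_mono G F (le_max_left _ _) hxg
  · rintro _ ⟨a, ha, b, hb, rfl⟩
    exact K.mul_mem (hsub N ha) (hsub N hb)

/-! ### Formulas about definable subgroups -/

/-- The formula `xₐ ∈ solutionSet φ`. -/
def memFormula {α : Type*} (φ : groupLanguage.Formula Unit) (a : α) : groupLanguage.Formula α :=
  φ.relabel fun _ => a

theorem realize_memFormula {α G : Type*} [Group G] (φ : groupLanguage.Formula Unit) (a : α)
    (v : α → G) : (memFormula φ a).Realize v ↔ v a ∈ solutionSet G φ := by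
  rw [memFormula, FirstOrder.Language.Formula.realize_relabel]
  rfl

/-- The formula `xₐ⁻¹ * x_b ∈ solutionSet φ`. -/
noncomputable def invMulMemFormula {α : Type*} (φ : groupLanguage.Formula Unit) (a b : α) :
    groupLanguage.Formula α :=
  FirstOrder.Language.Formula.iExs Unit
    (mulEqFormula (Sum.inl a) (Sum.inr ()) (Sum.inl b) ⊓ memFormula φ (Sum.inr ()))

theorem realize_invMulMemFormula {α G : Type*} [Group G] (φ : groupLanguage.Formula Unit)
    (a b : α) (v : α → G) :
    (invMulMemFormula φ a b).Realize v ↔ (v a)⁻¹ * v b ∈ solutionSet G φ := by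
  simp only [invMulMemFormula, FirstOrder.Language.Formula.realize_iExs,
    FirstOrder.Language.Formula.realize_inf, realize_mulEqFormula, realize_memFormula,
    Sum.elim_inl, Sum.elim_inr]
  constructor
  · rintro ⟨z, hz, hz'⟩
    rwa [← hz, inv_mul_cancel_left]
  · exact fun h => ⟨fun _ => (v a)⁻¹ * v b, mul_inv_cancel_left _ _, h⟩

/-- The formula defining the product of the set defined by `φ` with itself. -/
noncomputable def mulSelfFormula (φ : groupLanguage.Formula Unit) : groupLanguage.Formula Unit :=
  FirstOrder.Language.Formula.iExs Unit
    (memFormula φ (Sum.inr ()) ⊓ invMulMemFormula φ (Sum.inr ()) (Sum.inl ()))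

open scoped Pointwise in
theorem solutionSet_mulSelfFormula (G : Type*) [Group G] (φ : groupLanguage.Formula Unit) :
    solutionSet G (mulSelfFormula φ) = solutionSet G φ * solutionSet G φ := by
  ext x
  rw [Set.mem_mul]
  constructor
  · intro h
    simp only [solutionSet, mulSelfFormula, Set.mem_ofPred_eq] at h
    rw [FirstOrder.Language.Formula.realize_iExs] at h
    obtain ⟨y, hy⟩ := h
    rw [FirstOrder.Language.Formula.realize_inf, realize_memFormula,
      realize_invMulMemFormula] at hy
    exact ⟨y (), hy.1, _, hy.2, mul_inv_cancel_left _ _⟩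
  · rintro ⟨y, hy, z, hz, rfl⟩
    simp only [solutionSet, mulSelfFormula, Set.mem_ofPred_eq]
    rw [FirstOrder.Language.Formula.realize_iExs]
    refine ⟨fun _ => y, ?_⟩
    rw [FirstOrder.Language.Formula.realize_inf, realize_memFormula, realize_invMulMemFormula]
    refine ⟨hy, ?_⟩
    simpa using hz

/-- The sentence stating that the set defined by `φ` is closed under `(x, y) ↦ x⁻¹ * y`. -/
noncomputable def invMulClosedFormula (φ : groupLanguage.Formula Unit) :
    groupLanguage.Formula Empty :=
  FirstOrder.Language.Formula.iAlls (Fin 2)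
    ((memFormula φ (Sum.inr 0)).imp
      ((memFormula φ (Sum.inr 1)).imp (invMulMemFormula φ (Sum.inr 0) (Sum.inr 1))))

theorem realize_invMulClosedFormula {G : Type*} [Group G] (φ : groupLanguage.Formula Unit)
    (v : Empty → G) : (invMulClosedFormula φ).Realize v ↔
      ∀ x ∈ solutionSet G φ, ∀ y ∈ solutionSet G φ, x⁻¹ * y ∈ solutionSet G φ := by
  simp only [invMulClosedFormula, FirstOrder.Language.Formula.realize_iAlls,
    FirstOrder.Language.Formula.realize_imp, realize_memFormula, realize_invMulMemFormula,
    Sum.elim_inr]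
  constructor
  · intro h x hx y hy
    exact h ![x, y] hx hy
  · exact fun h i hx hy => h _ hx _ hy

/-- The sentence stating that `r` left translates of the set defined by `φ` cover the group. -/
noncomputable def coverFormula (φ : groupLanguage.Formula Unit) (r : ℕ) :
    groupLanguage.Formula Empty :=
  FirstOrder.Language.Formula.iExs (Fin r) (FirstOrder.Language.Formula.iAlls Unit
    (FirstOrder.Language.Formula.iSup fun i : Fin r =>
      invMulMemFormula φ (Sum.inl (Sum.inr i)) (Sum.inr ())))

theorem realize_coverFormula {G : Type*} [Group G] (φ : groupLanguage.Formula Unit) (r : ℕ)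
    (v : Empty → G) : (coverFormula φ r).Realize v ↔
      ∃ t : Fin r → G, ∀ x, ∃ i, (t i)⁻¹ * x ∈ solutionSet G φ := by
  simp only [coverFormula, FirstOrder.Language.Formula.realize_iExs,
    FirstOrder.Language.Formula.realize_iAlls, FirstOrder.Language.Formula.realize_iSup,
    realize_invMulMemFormula, Sum.elim_inr, Sum.elim_inl]
  refine exists_congr fun t => ⟨fun h x => h fun _ => x, fun h i => h (i ())⟩

/-! ### Transfer of definable open subgroups to the second group -/

/-- An elementary map preserves formulas in finitely many variables of any kind. -/
theorem IsElementaryMap.realize_iff {L : FirstOrder.Language} {M N : Type*} [L.Structure M]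
    [L.Structure N] {A : Set M} {f : A → N} (hf : IsElementaryMap L A f) {ι : Type*} [Finite ι]
    (φ : L.Formula ι) (a : ι → A) :
    φ.Realize (fun i => (a i : M)) ↔ φ.Realize (fun i => f (a i)) := by
  have e := Finite.equivFin ι
  have h := hf (φ.relabel e) (a ∘ e.symm)
  simpa [FirstOrder.Language.Formula.realize_relabel, Function.comp_def] using h

/-- `φ` defines the open subgroup `K` of `G` and the open subgroup `K'` of `H`, and the index of
`K'` is finite and at most that of `K`. -/
structure DefinesOpenSubgroups {G H : Type*} [Group G] [TopologicalSpace G] [Group H]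
    [TopologicalSpace H] (φ : groupLanguage.Formula Unit) (K : Subgroup G) (K' : Subgroup H) :
    Prop where
  left_eq : solutionSet G φ = K
  right_eq : solutionSet H φ = K'
  isOpen_left : IsOpen (K : Set G)
  isOpen_right : IsOpen (K' : Set H)
  index_le : K'.index ≤ K.index

open scoped Pointwise in
/-- If `G` is strongly complete and `H` satisfies the same sentences, then for each finite group `F`
some formula defines open subgroups of `G` and of `H` that are contained in the kernels of all
homomorphisms to `F`. -/
theorem IsStronglyComplete.exists_definesOpenSubgroups {G H : Type*} [Group G]
    [TopologicalSpace G] [IsTopologicalGroup G] [CompactSpace G] [T2Space G]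
    [Group H] [TopologicalSpace H] [IsTopologicalGroup H] [CompactSpace H] [T2Space H]
    (hG : IsStronglyComplete G)
    (hGH : ∀ (φ : groupLanguage.Formula Empty) (v : Empty → G) (w : Empty → H),
      φ.Realize v → φ.Realize w)
    (F : Type*) [Group F] [Finite F] :
    ∃ (φ : groupLanguage.Formula Unit) (K : Subgroup G) (K' : Subgroup H),
      DefinesOpenSubgroups φ K K' ∧ (∀ h : G →* F, K ≤ h.ker) ∧ ∀ h : H →* F, K' ≤ h.ker := by
  obtain ⟨m, hKo, hK⟩ := hG.exists_eq_forcedTrivial_mul G F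
  set K : Subgroup G := ⨅ h : G →* F, h.ker
  let φ := mulSelfFormula (forcedTrivialFormula F m)
  have hφG : solutionSet G φ = K := by
    rw [solutionSet_mulSelfFormula, solutionSet_forcedTrivialFormula, hK]
  have hφH : solutionSet H φ = forcedTrivial H F m * forcedTrivial H F m := by
    rw [solutionSet_mulSelfFormula, solutionSet_forcedTrivialFormula]
  have hinv : ∀ x ∈ solutionSet H φ, ∀ y ∈ solutionSet H φ, x⁻¹ * y ∈ solutionSet H φ := by
    refine (realize_invMulClosedFormula φ Empty.elim).1
      (hGH _ Empty.elim _ ((realize_invMulClosedFormula φ _).2 ?_))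
    rw [hφG]
    exact fun x hx y hy => K.mul_mem (K.inv_mem hx) hy
  have hone : (1 : H) ∈ solutionSet H φ := by
    rw [hφH]
    exact ⟨1, one_mem_forcedTrivial H F m, 1, one_mem_forcedTrivial H F m, one_mul 1⟩
  have hinv' : ∀ x ∈ solutionSet H φ, x⁻¹ ∈ solutionSet H φ := fun x hx => by
    simpa using hinv x hx 1 hone
  let K' : Subgroup H :=
    { carrier := solutionSet H φ
      one_mem' := hone
      inv_mem' := fun {x} hx => hinv' x hx
      mul_mem' := fun {x y} hx hy => by simpa using hinv _ (hinv' x hx) y hy }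
  have hfin : Finite (G ⧸ K) := K.quotient_finite_of_isOpen hKo
  -- Coset representatives of `K` show that the covering sentence holds in `G`; transferred, it
  -- bounds the index of `K'`.
  obtain ⟨t, ht⟩ : ∃ t : Fin K.index → H, ∀ x, ∃ i, (t i)⁻¹ * x ∈ K' := by
    refine (realize_coverFormula φ K.index Empty.elim).1
      (hGH _ Empty.elim _ ((realize_coverFormula φ K.index _).2 ?_))
    have e : Fin K.index ≃ G ⧸ K := (Finite.equivFin (G ⧸ K)).symm
    refine ⟨fun i => (e i).out, fun x => ⟨e.symm x, ?_⟩⟩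
    rw [hφG, SetLike.mem_coe, ← QuotientGroup.eq]
    simp
  have hsurj : Function.Surjective fun i => (t i : H ⧸ K') := by
    intro q
    induction q using QuotientGroup.induction_on with | H x => ?_
    obtain ⟨i, hi⟩ := ht x
    exact ⟨i, QuotientGroup.eq.2 hi⟩
  have hfin' : Finite (H ⧸ K') := Finite.of_surjective _ hsurj
  have : K'.FiniteIndex := Subgroup.finiteIndex_of_finite_quotient
  -- Strong completeness of `H` is not available: openness comes from finite index and closedness as
  -- a product of two compact sets.
  have hcl : IsClosed (K' : Set H) := by
    change IsClosed (solutionSet H φ)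
    rw [hφH]
    have h := (isClosed_forcedTrivial H F m).isCompact
    exact (h.mul h).isClosed
  refine ⟨φ, K, K', ⟨hφG, rfl, hKo, K'.isOpen_of_isClosed_of_finiteIndex hcl, ?_⟩,
    fun h => iInf_le _ h, fun h x hx => ?_⟩
  · simpa [Subgroup.index] using Nat.card_le_card_of_surjective _ hsurj
  · have hx' : x ∈ forcedTrivial H F m * forcedTrivial H F m := hφH ▸ hx
    obtain ⟨a, ha, b, hb, rfl⟩ := hx'
    rw [MonoidHom.mem_ker]
    simp [map_eq_one_of_mem_forcedTrivial ha, map_eq_one_of_mem_forcedTrivial hb]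

/-! ### Extension of the elementary map by compactness -/

/-- An elementary map between compact groups extends to a homomorphism compatible with all
subgroups definable by a single formula that are open on both sides. -/
theorem IsElementaryMap.exists_monoidHom {G H : Type*} [Group G]
    [TopologicalSpace G] [IsTopologicalGroup G]
    [Group H] [TopologicalSpace H] [IsTopologicalGroup H] [CompactSpace H] [T2Space H]
    {A : Set G} {f : A → H} (hf : IsElementaryMap groupLanguage A f) :
    ∃ θ : G →* H, (∀ a : A, θ a = f a) ∧
      ∀ (φ : groupLanguage.Formula Unit) (K : Subgroup G) (K' : Subgroup H),
        DefinesOpenSubgroups φ K K' → ∀ g, θ g ∈ K' ↔ g ∈ K := by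
  classical
  let I := {t : groupLanguage.Formula Unit × Subgroup G × Subgroup H //
    DefinesOpenSubgroups t.1 t.2.1 t.2.2}
  let C : Finset G × Finset I → Set (G → H) := fun p =>
    {θ | (∀ a : A, (a : G) ∈ p.1 → θ a = f a) ∧
      (∀ g ∈ p.1, ∀ h ∈ p.1, g * h ∈ p.1 → θ g * θ h = θ (g * h)) ∧
      ∀ i ∈ p.2, ∀ g ∈ p.1, θ g ∈ i.1.2.2 ↔ g ∈ i.1.2.1}
  have hmono : ∀ p q, p ≤ q → C q ⊆ C p := fun p q hpq θ hθ =>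
    ⟨fun a ha => hθ.1 a (hpq.1 ha), fun g hg h hh hgh =>
      hθ.2.1 g (hpq.1 hg) h (hpq.1 hh) (hpq.1 hgh),
      fun i hi g hg => hθ.2.2 i (hpq.2 hi) g (hpq.1 hg)⟩
  have hcl : ∀ p, IsClosed (C p) := by
    intro p
    simp only [C, Set.ofPred_and, Set.ofPred_forall]
    refine IsClosed.inter ?_ (IsClosed.inter ?_ ?_)
    · exact isClosed_iInter fun a => isClosed_iInter fun _ =>
        isClosed_eq (continuous_apply _) continuous_const
    · exact isClosed_iInter fun g => isClosed_iInter fun _ => isClosed_iInter fun h =>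
        isClosed_iInter fun _ => isClosed_iInter fun _ =>
          isClosed_eq ((continuous_apply g).mul (continuous_apply h)) (continuous_apply _)
    · refine isClosed_iInter fun i => isClosed_iInter fun _ => isClosed_iInter fun g =>
        isClosed_iInter fun _ => ?_
      by_cases hg : g ∈ i.1.2.1
      · simp only [hg, iff_true]
        exact IsClosed.preimage (continuous_apply (A := fun _ : G => H) g)
          (i.1.2.2.isClosed_of_isOpen i.2.isOpen_right)
      · simp only [hg, iff_false]
        exact IsClosed.preimage (continuous_apply (A := fun _ : G => H) g)
          (isClosed_compl_iff.2 i.2.isOpen_right)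
  have hne : ∀ p, (C p).Nonempty := by
    rintro ⟨s, J⟩
    have : Finite {a : A // (a : G) ∈ s} := Finite.of_injective
      (fun a => (⟨a.1, a.2⟩ : s)) fun a b hab =>
        Subtype.ext (Subtype.ext (Subtype.mk.inj hab))
    -- The `inl` variables are parameters from `A`; the `inr` variables stand for the images of
    -- elements of `s` and get quantified. The identity satisfies `Ψ` in `G`.
    let Ψ : groupLanguage.Formula ({a : A // (a : G) ∈ s} ⊕ s) :=
      FirstOrder.Language.Formula.iInf (fun a : {a : A // (a : G) ∈ s} =>
        FirstOrder.Language.Term.equal (FirstOrder.Language.Term.var (Sum.inr ⟨a.1, a.2⟩))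
          (FirstOrder.Language.Term.var (Sum.inl a))) ⊓
      (FirstOrder.Language.Formula.iInf (fun t : {t : s × s × s // (t.1 : G) * t.2.1 = t.2.2} =>
        mulEqFormula (Sum.inr t.1.1) (Sum.inr t.1.2.1) (Sum.inr t.1.2.2)) ⊓
      FirstOrder.Language.Formula.iInf (fun t : J × s =>
        if (t.2 : G) ∈ t.1.1.1.2.1 then memFormula t.1.1.1.1 (Sum.inr t.2)
          else (memFormula t.1.1.1.1 (Sum.inr t.2)).not))
    have hG : (Ψ.iExs s).Realize fun a : {a : A // (a : G) ∈ s} => ((a : A) : G) := by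
      rw [FirstOrder.Language.Formula.realize_iExs]
      refine ⟨fun g => g, ?_⟩
      simp only [Ψ, FirstOrder.Language.Formula.realize_inf,
        FirstOrder.Language.Formula.realize_iInf, FirstOrder.Language.Formula.realize_equal,
        FirstOrder.Language.Term.realize_var, realize_mulEqFormula, Sum.elim_inl, Sum.elim_inr]
      refine ⟨fun _ => trivial, fun t => t.2, fun t => ?_⟩
      split_ifs with h
      · rw [realize_memFormula, t.1.1.2.left_eq]
        exact h
      · rw [FirstOrder.Language.Formula.realize_not, realize_memFormula, t.1.1.2.left_eq]
        exact h
    rw [hf.realize_iff, FirstOrder.Language.Formula.realize_iExs] at hG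
    obtain ⟨w, hw⟩ := hG
    simp only [Ψ, FirstOrder.Language.Formula.realize_inf,
      FirstOrder.Language.Formula.realize_iInf, FirstOrder.Language.Formula.realize_equal,
      FirstOrder.Language.Term.realize_var, realize_mulEqFormula, Sum.elim_inl, Sum.elim_inr] at hw
    obtain ⟨h₁, h₂, h₃⟩ := hw
    -- The value 1 outside `s` is arbitrary, since `C` constrains only points of `s`.
    refine ⟨fun g => if h : g ∈ s then w ⟨g, h⟩ else 1, fun a ha => ?_, fun g hg h hh hgh => ?_,
      fun i hi g hg => ?_⟩
    · simpa [ha] using h₁ ⟨a, ha⟩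
    · simpa [hg, hh, hgh] using h₂ ⟨(⟨g, hg⟩, ⟨h, hh⟩, ⟨g * h, hgh⟩), rfl⟩
    · have h := h₃ (⟨i, hi⟩, ⟨g, hg⟩)
      replace hg : g ∈ s := hg
      simp only [hg, dite_true]
      split_ifs at h with hK
      · rw [realize_memFormula, i.2.right_eq] at h
        exact iff_of_true h hK
      · rw [FirstOrder.Language.Formula.realize_not, realize_memFormula, i.2.right_eq] at h
        exact iff_of_false h hK
  obtain ⟨θ, hθ⟩ := IsCompact.nonempty_iInter_of_directed_nonempty_isCompact_isClosed C
    (fun p q => ⟨p ⊔ q, hmono _ _ le_sup_left, hmono _ _ le_sup_right⟩) hne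
    (fun p => (hcl p).isCompact) hcl
  rw [Set.mem_iInter] at hθ
  refine ⟨MonoidHom.mk' θ fun a b => ?_, fun a => ?_, fun φ K K' h g => ?_⟩
  · exact ((hθ ({a, b, a * b}, ∅)).2.1 a (by simp) b (by simp) (by simp)).symm
  · exact (hθ ({(a : G)}, ∅)).1 a (by simp)
  · exact (hθ ({g}, {⟨(φ, K, K'), h⟩})).2.2 ⟨(φ, K, K'), h⟩ (by simp) g (by simp)

/-! ### The extension is an isomorphism -/

/-- The case in which the source of the elementary map is strongly complete. -/
theorem IsElementaryMap.exists_continuousMulEquiv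
    {G : Type*} [Group G] [TopologicalSpace G] [IsTopologicalGroup G]
    [CompactSpace G] [TotallyDisconnectedSpace G]
    {H : Type*} [Group H] [TopologicalSpace H] [IsTopologicalGroup H]
    [CompactSpace H] [TotallyDisconnectedSpace H]
    {A : Set G} {f : A → H} (hf : IsElementaryMap groupLanguage A f)
    (hG : IsStronglyComplete G) : ∃ e : G ≃ₜ* H, ∀ a : A, e (a : G) = f a := by
  obtain ⟨θ, hθA, hθ⟩ := hf.exists_monoidHom
  have hGH : ∀ (φ : groupLanguage.Formula Empty) (v : Empty → G) (w : Empty → H),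
      φ.Realize v → φ.Realize w := fun φ v w h => by
    have h' := hf.realize_iff φ Empty.elim
    rw [Subsingleton.elim (fun i : Empty => ((Empty.elim i : A) : G)) v,
      Subsingleton.elim (fun i : Empty => f (Empty.elim i)) w] at h'
    exact h'.1 h
  have hfinG : ∀ N : OpenNormalSubgroup G, Finite (G ⧸ N.toSubgroup) := fun N =>
    N.toSubgroup.quotient_finite_of_isOpen N.isOpen'
  have hfinH : ∀ N : OpenNormalSubgroup H, Finite (H ⧸ N.toSubgroup) := fun N =>
    N.toSubgroup.quotient_finite_of_isOpen N.isOpen'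
  have hinj : Function.Injective θ := by
    refine (injective_iff_map_eq_one θ).2 fun g hg => ?_
    by_contra hne
    obtain ⟨N, hN⟩ := ProfiniteGrp.exist_openNormalSubgroup_sub_open_nhds_of_one
      (isOpen_compl_singleton (x := g)) (Ne.symm hne)
    have := hfinG N
    -- With `F = G ⧸ N`, the quotient map is among the homomorphisms considered, so `K ≤ N`.
    obtain ⟨φ, K, K', hφ, hK, -⟩ :=
      hG.exists_definesOpenSubgroups (H := H) hGH (G ⧸ N.toSubgroup)
    have hgK : g ∈ K := (hθ φ K K' hφ g).1 (hg ▸ K'.one_mem)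
    have hgN := hK (QuotientGroup.mk' N.toSubgroup) hgK
    rw [QuotientGroup.ker_mk'] at hgN
    exact hN hgN rfl
  have hcont : Continuous θ := by
    refine continuous_of_continuousAt_one θ fun U hU => ?_
    rw [map_one, mem_nhds_iff] at hU
    obtain ⟨V, hVU, hVo, hV1⟩ := hU
    obtain ⟨N, hN⟩ := ProfiniteGrp.exist_openNormalSubgroup_sub_open_nhds_of_one hVo hV1
    have := hfinH N
    obtain ⟨φ, K, K', hφ, -, hK'⟩ :=
      hG.exists_definesOpenSubgroups (H := H) hGH (H ⧸ N.toSubgroup)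
    rw [Filter.mem_map]
    refine Filter.mem_of_superset (hφ.isOpen_left.mem_nhds K.one_mem) fun g hg => ?_
    have hgN := hK' (QuotientGroup.mk' N.toSubgroup) ((hθ φ K K' hφ g).2 hg)
    rw [QuotientGroup.ker_mk'] at hgN
    exact hVU (hN hgN)
  have hsurj : Function.Surjective θ := by
    intro h
    by_contra hh
    have hcl : IsClosed (Set.range θ) := (isCompact_range hcont).isClosed
    -- A coset `h * N` will miss the image, yet the image meets every coset of `K' ≤ N`.
    have hV : IsOpen ((fun x => h * x) ⁻¹' (Set.range θ)ᶜ) :=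
      hcl.isOpen_compl.preimage (continuous_const_mul h)
    obtain ⟨N, hN⟩ := ProfiniteGrp.exist_openNormalSubgroup_sub_open_nhds_of_one hV
      (show h * 1 ∉ Set.range θ by rwa [mul_one])
    have := hfinH N
    obtain ⟨φ, K, K', hφ, -, hK'⟩ :=
      hG.exists_definesOpenSubgroups (H := H) hGH (H ⧸ N.toSubgroup)
    have hmap : ∀ a b : G, a⁻¹ * b ∈ K ↔ (θ a)⁻¹ * θ b ∈ K' := fun a b => by
      rw [← hθ φ K K' hφ, map_mul, map_inv]
    let θ' : G ⧸ K → H ⧸ K' := Quotient.map' θ fun a b hab =>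
      QuotientGroup.leftRel_apply.2 ((hmap a b).1 (QuotientGroup.leftRel_apply.1 hab))
    have hθ' : Function.Injective θ' := by
      intro p q
      induction p using QuotientGroup.induction_on with | H a => ?_
      induction q using QuotientGroup.induction_on with | H b => ?_
      exact fun hab => QuotientGroup.eq.2 ((hmap a b).2 (QuotientGroup.eq.1 hab))
    have : Finite (H ⧸ K') := K'.quotient_finite_of_isOpen hφ.isOpen_right
    -- The injection of coset spaces is onto because the index of `K'` is at most that of `K`.
    obtain ⟨q, hq⟩ := (hθ'.bijective_of_nat_card_le hφ.index_le).2 (h : H ⧸ K')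
    induction q using QuotientGroup.induction_on with | H a => ?_
    have ha := hK' (QuotientGroup.mk' N.toSubgroup) (QuotientGroup.eq.1 hq.symm)
    rw [QuotientGroup.ker_mk'] at ha
    exact hN ha ⟨a, by simp⟩
  let e : G ≃* H := MulEquiv.ofBijective θ ⟨hinj, hsurj⟩
  exact ⟨{ e with
    continuous_toFun := hcont
    continuous_invFun := Continuous.continuous_symm_of_equiv_compact_to_t2 (f := e.toEquiv) hcont },
    hθA⟩

/-- An elementary map is injective, and its inverse is elementary. -/
theorem IsElementaryMap.exists_inverse {L : FirstOrder.Language} {M N : Type*} [L.Structure M]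
    [L.Structure N] {A : Set M} {f : A → N} (hf : IsElementaryMap L A f) :
    ∃ g : Set.range f → M, IsElementaryMap L (Set.range f) g ∧
      ∀ a : A, g ⟨f a, a, rfl⟩ = a := by
  have hinj : Function.Injective f := by
    intro a b hab
    have h := hf (FirstOrder.Language.Term.equal (FirstOrder.Language.Term.var 0)
      (FirstOrder.Language.Term.var 1)) ![a, b]
    simp only [FirstOrder.Language.Formula.realize_equal,
      FirstOrder.Language.Term.realize_var] at h
    exact Subtype.ext (h.2 hab)
  let e := Equiv.ofInjective f hinj
  refine ⟨fun y => e.symm y, fun n φ a => ?_, fun a => ?_⟩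
  · rw [hf φ fun i => e.symm (a i)]
    have : ∀ i, f (e.symm (a i)) = a i := fun i =>
      congrArg Subtype.val (e.apply_symm_apply (a i))
    simp only [this]
  · exact congrArg Subtype.val (e.symm_apply_apply a)

/-- Let `G` and `H` be profinite groups, `A ⊆ G`, and `f : A → H` an elementary map in the language
of groups. If one of the groups is strongly complete, then `f` extends to an isomorphism of
profinite groups (an isomorphism of groups that is a homeomorphism). -/
theorem mainTheorem9
    {G : Type*} [Group G] [TopologicalSpace G] [IsTopologicalGroup G]
    [CompactSpace G] [TotallyDisconnectedSpace G]
    {H : Type*} [Group H] [TopologicalSpace H] [IsTopologicalGroup H]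
    [CompactSpace H] [TotallyDisconnectedSpace H]
    (A : Set G) (f : A → H)
    (hf : IsElementaryMap groupLanguage A f)
    (hsc : IsStronglyComplete G ∨ IsStronglyComplete H) :
    ∃ e : G ≃ₜ* H, ∀ a : A, e (a : G) = f a := by
  obtain hG | hH := hsc
  · exact hf.exists_continuousMulEquiv hG
  · obtain ⟨g, hg, hgf⟩ := hf.exists_inverse
    obtain ⟨e, he⟩ := hg.exists_continuousMulEquiv hH
    refine ⟨e.symm, fun a => ?_⟩
    rw [← hgf a, ← he ⟨f a, a, rfl⟩]
    exact e.symm_apply_apply _
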